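/- Let $\mathbb{N}=\{1,2,3,\dots\}$. A *Bohr almost periodic sequence* is a function $\psi:\mathbb{N}\to\mathbb{C}$ that is a uniform limit on $\mathbb{N}$ of trigonometric polynomials, i.e. of functions of the form $n\mapsto\sum_{j=1}^{k}c_j e^{2\pi i n\alpha_j}$ with $c_j\in\mathbb{C}$, $\alpha_j\in\mathbb{R}$. A set $E\subset\mathbb{N}$ is an *$I_0$-set* if every bounded function $E\to\mathbb{C}$ extends to a Bohr almost periodic sequence. A set $R\subset\mathbb{N}$ is a *set of Bohr recurrence* if for every $d$ and every $\alpha\in\mathbb{T}^d=\mathbb{R}^d/\mathbb{Z}^d$ the point $0$ lies in the closure of $\{n\alpha : n\in R\}$. A sequence $r_1<r_2<\cdots$ in $\mathbb{N}$ is *lacunary* if $\inf_{n}\, r_{n+1}/r_n>1$. **Proposition.** Let $(r_n)_{n\in\mathbb{N}}$ be a lacunary sequence in $\mathbb{N}$ and let $(t_n)_{n\in\mathbb{N}}$ be a sequence in $\mathbb{N}$ with $\lim_{n\to\infty}t_n/r_n=0$. Then $E=\{r_n : n\in\mathbb{N}\}\cup\{r_n+t_n : n\in\mathbb{N}\}$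 is an $I_0$-set if and only if $\{t_n : n\in\mathbb{N}\}$ is not a set of Bohr recurrence. -/

import Mathlib

/-- Sequences are defined on the positive integers `ℕ+`.
`P` is a trigonometric polynomial: `P(n) = ∑ j, c_j e^{2 π i n α_j}`, with `c_j ∈ ℂ`, `α_j ∈ ℝ`. -/
def IsTrigPolynomial (P : ℕ+ → ℂ) : Prop :=
  ∃ (k : ℕ) (c : Fin k → ℂ) (α : Fin k → ℝ), ∀ n : ℕ+,
    P n = ∑ j, c j * Complex.exp (2 * (Real.pi : ℂ) * Complex.I * ((n : ℕ) : ℂ) * (α j : ℂ))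

/-- A Bohr almost periodic sequence: a uniform limit of trigonometric polynomials. -/
def IsBohrAlmostPeriodic (ψ : ℕ+ → ℂ) : Prop :=
  ∀ ε : ℝ, 0 < ε → ∃ P : ℕ+ → ℂ, IsTrigPolynomial P ∧ ∀ n : ℕ+, ‖ψ n - P n‖ < ε

/-- `E` is an `I₀`-set: every bounded complex function on `E` extends to a Bohr almost periodic
sequence. -/
def IsI0Set (E : Set ℕ+) : Prop :=
  ∀ f : E → ℂ, (∃ C : ℝ, ∀ x : E, ‖f x‖ ≤ C) →
    ∃ ψ : ℕ+ → ℂ, IsBohrAlmostPeriodic ψ ∧ ∀ x : E, ψ (x : ℕ+) = f x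

/-- `r_0 < r_1 < ⋯` is lacunary: `inf_n r_{n+1} / r_n > 1`. (The ratios are bounded below by `0`,
so this real infimum is the genuine one.) -/
def IsLacunarySeq (r : ℕ → ℕ+) : Prop :=
  StrictMono r ∧ 1 < ⨅ n : ℕ, ((r (n + 1) : ℕ) : ℝ) / ((r n : ℕ) : ℝ)

/-- `R` is a set of Bohr recurrence: for every `d` and every `α` in the torus `(ℝ/ℤ)^d`, the point
`0` is in the closure of `{n α : n ∈ R}`. -/
def IsBohrRecurrent (R : Set ℕ+) : Prop :=
  ∀ (d : ℕ) (α : Fin d → UnitAddCircle),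
    (0 : Fin d → UnitAddCircle) ∈ closure ((fun n : ℕ+ => (n : ℕ) • α) '' R)

/-!
A continuous function on the compact group of all maps from the circle to itself restricts, along
`n ↦ (x ↦ n • x)`, to a Bohr almost periodic sequence (Stone–Weierstrass). So, by Tietze's theorem,
`E` is an `I₀`-set as soon as distinct ultrafilters on `E` have distinct limits in this group
(`isI0Set_of_injective_limits`).

For a lacunary sequence `s` this separation holds (`EventuallyLacunary.map_eq_map`). If `u` at least
quadruples at each step, the values `u n • x` can be prescribed up to `1 / 6` by the choice of one
point `x` of the circle. For two nonprincipal ultrafilters on the index set there are two cases.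
Either one is a shift of the other by `j ≠ 0`, and then the differences `s (n + j) - s n` can be kept
near `1 / 2`; or they contain sets of indices that are so far apart that `s` quadruples along their
union, and the two sets can be sent near `0` and near `1 / 2`. For a nonprincipal ultrafilter against
a single index `a`, the differences `s n - s a` play the same role.

Now consider ultrafilters `U` and `V` of indices, the first used along `r` and the second along
`r + t`. If `U ≠ V`, some mixture of the two sequences, equal to `r n` on a set in `U` and to
`r n + t n` on its complement, carries both; it is eventually lacunary since `t n / r n → 0`, and the
lacunary case applies. If `U = V` and the limits agree, then `t n • x` tends to `0` along `U` for all
`x`, and `t` is recurrent.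

Conversely, a trigonometric polynomial varies little between `m` and `m + t n` for suitable return
times `t n`, uniformly in `m`; so a recurrent `t` prevents almost periodic sequences from separating
`r n` from `r n + t n` for all large `n`.
-/

open Filter Topology Set

/-! ### Prescribing a quadrupling sequence on the circle -/

/-- If each `u (k + 1)` is at least `4 u k`, then the values of `u k * x` modulo `1` can be
prescribed simultaneously, up to an error of `1 / 6`. The point `x` is the limit of points `y k`,
where `y (k + 1)` is a point nearest to `y k` with `u (k + 1) * y (k + 1) ≡ θ (k + 1)`; the later
corrections move `u k * y k` by at most `(1 / 2) * (1 / 4 + 1 / 16 + ⋯) = 1 / 6`. -/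
theorem exists_real_forall_abs_mul_sub_le {u : ℕ → ℝ} (hu0 : 0 < u 0)
    (hu : ∀ k, 4 * u k ≤ u (k + 1)) (θ : ℕ → ℝ) :
    ∃ x : ℝ, ∀ k, ∃ m : ℤ, |u k * x - θ k - m| ≤ 1 / 6 := by
  have hpos : ∀ k, 0 < u k := by
    intro k
    induction k with
    | zero => exact hu0
    | succ k ih => linarith [hu k]
  let y : ℕ → ℝ := fun k => Nat.rec (θ 0 / u 0)
    (fun k x => (θ (k + 1) + round (u (k + 1) * x - θ (k + 1))) / u (k + 1)) k
  have hys : ∀ k, y (k + 1)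
      = (θ (k + 1) + round (u (k + 1) * y k - θ (k + 1))) / u (k + 1) := fun _ => rfl
  have hy : ∀ k, ∃ m : ℤ, u k * y k = θ k + m := by
    intro k
    have hk := (hpos k).ne'
    cases k with
    | zero =>
      refine ⟨0, ?_⟩
      change u 0 * (θ 0 / u 0) = _
      field_simp
      simp
    | succ k =>
      refine ⟨round (u (k + 1) * y k - θ (k + 1)), ?_⟩
      rw [hys]
      field_simp
  have hstep : ∀ k, u (k + 1) * |y k - y (k + 1)| ≤ 1 / 2 := by
    intro k
    have hk := hpos (k + 1)
    have h : u (k + 1) * (y k - y (k + 1)) = (u (k + 1) * y k - θ (k + 1))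
        - round (u (k + 1) * y k - θ (k + 1)) := by
      rw [hys]
      field_simp
      ring
    calc u (k + 1) * |y k - y (k + 1)| = |u (k + 1) * (y k - y (k + 1))| := by
          rw [abs_mul, abs_of_pos hk]
      _ ≤ 1 / 2 := h ▸ abs_sub_round _
  have hgrow : ∀ k n, 4 ^ n * u k ≤ u (k + n) := by
    intro k n
    induction n with
    | zero => simp
    | succ n ih =>
      have := hu (k + n)
      rw [← add_assoc, pow_succ]
      linarith
  have hgeom : ∀ k n, dist (y (k + n)) (y (k + n + 1)) ≤ 1 / (8 * u k) * (1 / 4) ^ n := by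
    intro k n
    have h1 := hstep (k + n)
    have h2 := hgrow k (n + 1)
    have hk := hpos k
    rw [Real.dist_eq, one_div_pow, div_mul_div_comm, one_mul, le_div_iff₀ (by positivity)]
    have h3 := mul_le_mul_of_nonneg_right h2 (abs_nonneg (y (k + n) - y (k + n + 1)))
    rw [← add_assoc] at h3
    rw [pow_succ] at h3
    linarith
  obtain ⟨x, hx⟩ := cauchySeq_tendsto_of_complete
    (cauchySeq_of_le_geometric (f := y) (1 / 4) (1 / (8 * u 0)) (by norm_num)
      (fun n => by simpa using hgeom 0 n))
  refine ⟨x, fun k => ?_⟩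
  obtain ⟨m, hm⟩ := hy k
  refine ⟨m, ?_⟩
  have hk := hpos k
  have hlim : Tendsto (fun n => y (k + n)) atTop (𝓝 x) := by
    simpa [add_comm] using (tendsto_add_atTop_iff_nat k).2 hx
  have hd := dist_le_of_le_geometric_of_tendsto₀ (f := fun n => y (k + n)) (1 / 4)
    (1 / (8 * u k)) (by norm_num) (hgeom k) hlim
  rw [Real.dist_eq, abs_sub_comm] at hd
  have he : u k * x - θ k - m = u k * (x - y k) := by rw [mul_sub, hm]; ring
  rw [he, abs_mul, abs_of_pos hk]
  calc u k * |x - y k| ≤ u k * (1 / (8 * u k) / (1 - 1 / 4)) := by gcongr; exact hd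
    _ = 1 / 6 := by field_simp; norm_num

theorem UnitAddCircle.norm_coe_le_abs_sub_intCast (z : ℝ) (m : ℤ) :
    ‖(z : UnitAddCircle)‖ ≤ |z - m| := by
  rw [UnitAddCircle.norm_eq]
  exact round_le z m

theorem UnitAddCircle.norm_half : ‖((1 / 2 : ℝ) : UnitAddCircle)‖ = 1 / 2 := by
  rw [UnitAddCircle.norm_eq]
  norm_num [round_eq]

/-- The prescription of values on the circle along an infinite set `S` of indices on which `u`
quadruples. -/
theorem exists_forall_norm_nsmul_sub_le {S : Set ℕ} (hS : S.Infinite) {u : ℕ → ℕ}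
    (hpos : ∀ n ∈ S, 0 < u n) (hu : ∀ m ∈ S, ∀ n ∈ S, m < n → 4 * u m ≤ u n) (θ : ℕ → ℝ) :
    ∃ x : UnitAddCircle, ∀ n ∈ S, ‖u n • x - (θ n : UnitAddCircle)‖ ≤ 1 / 6 := by
  classical
  let e : ℕ → ℕ := Nat.nth (· ∈ S)
  have he : ∀ k, e k ∈ S := Nat.nth_mem_of_infinite hS
  obtain ⟨x, hx⟩ := exists_real_forall_abs_mul_sub_le (u := fun k => (u (e k) : ℝ))
    (by exact_mod_cast hpos _ (he 0))
    (fun k => by exact_mod_cast hu _ (he k) _ (he (k + 1)) (Nat.nth_strictMono hS k.lt_succ_self))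
    (fun k => θ (e k))
  refine ⟨x, fun n hn => ?_⟩
  obtain ⟨k, rfl⟩ : n ∈ range e := by
    exact (Nat.range_nth_of_infinite hS).symm ▸ hn
  obtain ⟨m, hm⟩ := hx k
  refine le_trans (le_of_eq_of_le ?_ (UnitAddCircle.norm_coe_le_abs_sub_intCast _ m)) hm
  simp

/-! ### Ultrafilters and quadrupling along bounded gaps -/

/-- From the index `N` on, `u` is positive and at least quadruples whenever the index increases by
more than `M`. -/
def EventuallyQuadruples (u : ℕ → ℕ) (M N : ℕ) : Prop :=
  ∀ n, N ≤ n → 0 < u n ∧ ∀ n', n + M < n' → 4 * u n ≤ u n'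

theorem Ultrafilter.exists_mod_eq (U : Ultrafilter ℕ) (M : ℕ) :
    ∃ i, ∀ᶠ n in (U : Filter ℕ), n % (M + 1) = i := by
  have h : ∀ᶠ n in (U : Filter ℕ), ∃ i ∈ Finset.range (M + 1), n % (M + 1) = i :=
    Eventually.of_forall fun n => ⟨_, Finset.mem_range.2 (Nat.mod_lt _ M.succ_pos), rfl⟩
  have h' : (⋃ i ∈ (Finset.range (M + 1) : Set ℕ), {n | n % (M + 1) = i}) ∈ U := by
    filter_upwards [h] with n hn
    simpa using hn
  obtain ⟨i, -, hi⟩ := (Ultrafilter.finite_biUnion_mem_iff (Finset.finite_toSet _)).1 h'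
  exact ⟨i, hi⟩

theorem add_lt_of_mod_eq {m n M : ℕ} (h : m % (M + 1) = n % (M + 1)) (hmn : m < n) :
    m + M < n := by
  have := Nat.add_le_of_le_sub hmn.le (Nat.le_of_dvd (Nat.sub_pos_of_lt hmn)
    ((Nat.modEq_iff_dvd' hmn.le).1 h))
  omega

theorem Ultrafilter.infinite_of_mem {U : Ultrafilter ℕ} (hU : (U : Filter ℕ) ≤ cofinite)
    {S : Set ℕ} (hS : S ∈ U) : S.Infinite := fun hf =>
  (Ultrafilter.compl_notMem_iff.2 hS) (hU hf.compl_mem_cofinite)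

/-- Along a nonprincipal ultrafilter, such a sequence does not converge to `0` in the Bohr topology:
on the residue class modulo `M + 1` chosen by the ultrafilter, all `u n • x` can be placed near
`1 / 2`. -/
theorem exists_not_tendsto_nsmul_zero {U : Ultrafilter ℕ} (hU : (U : Filter ℕ) ≤ cofinite)
    {u : ℕ → ℕ} {M N : ℕ} (hu : EventuallyQuadruples u M N) :
    ∃ x : UnitAddCircle, ¬ Tendsto (fun n => u n • x) U (𝓝 0) := by
  obtain ⟨i, hi⟩ := U.exists_mod_eq M
  have hN : ∀ᶠ n in (U : Filter ℕ), N ≤ n :=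
    hU (Nat.cofinite_eq_atTop ▸ eventually_ge_atTop N)
  have hS := hi.and hN
  obtain ⟨x, hx⟩ := exists_forall_norm_nsmul_sub_le (Ultrafilter.infinite_of_mem hU hS)
    (fun n hn => (hu n hn.2).1)
    (fun m hm n hn hmn => (hu m hm.2).2 n (add_lt_of_mod_eq (hm.1.trans hn.1.symm) hmn))
    (fun _ => 1 / 2)
  refine ⟨x, fun h => ?_⟩
  have h0 : ‖(0 : UnitAddCircle) - ((1 / 2 : ℝ) : UnitAddCircle)‖ ≤ 1 / 6 :=
    le_of_tendsto ((h.sub_const _).norm) (hS.mono hx)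
  rw [zero_sub, norm_neg, UnitAddCircle.norm_half] at h0
  norm_num at h0

/-! ### Eventually lacunary sequences -/

/-- From some index on, `s` is positive and grows at least by a fixed factor `q > 1` at each
step. No condition is put on the first terms, which for the sequence `r n + t n` may be out of
order. -/
def EventuallyLacunary (s : ℕ → ℕ) : Prop :=
  ∃ q : ℝ, 1 < q ∧ ∃ N, ∀ n, N ≤ n → 0 < s n ∧ q * s n ≤ s (n + 1)

theorem EventuallyLacunary.pow_mul_le {s : ℕ → ℕ} {q : ℝ} {N : ℕ} (hq : 1 < q)
    (h : ∀ n, N ≤ n → 0 < s n ∧ q * s n ≤ s (n + 1)) {n : ℕ} (hn : N ≤ n) (j : ℕ) :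
    q ^ j * s n ≤ s (n + j) := by
  induction j with
  | zero => simp
  | succ j ih =>
    calc q ^ (j + 1) * s n = q * (q ^ j * s n) := by ring
      _ ≤ q * s (n + j) := by gcongr
      _ ≤ s (n + (j + 1)) := (h (n + j) (by omega)).2

/-- A sequence that is eventually comparable to a lacunary sequence quadruples along bounded gaps,
although it need not be lacunary itself. -/
theorem EventuallyLacunary.eventuallyQuadruples {s : ℕ → ℕ} (hs : EventuallyLacunary s)
    {d : ℕ → ℕ} {c : ℝ} (hc : 0 < c) (hd : ∀ᶠ n in atTop, c * s n ≤ d n ∧ d n ≤ s n) :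
    ∃ M N, EventuallyQuadruples d M N := by
  obtain ⟨q, hq, N, h⟩ := hs
  obtain ⟨N', hN'⟩ := eventually_atTop.1 hd
  obtain ⟨M, hM⟩ := pow_unbounded_of_one_lt (4 / c) hq
  refine ⟨M, max N N', fun n hn => ⟨?_, fun n' hn' => ?_⟩⟩
  · have h1 := (h n (le_trans (le_max_left _ _) hn)).1
    have h2 := (hN' n (le_trans (le_max_right _ _) hn)).1
    have : (0 : ℝ) < d n := lt_of_lt_of_le (by positivity) h2
    exact_mod_cast this
  · obtain ⟨j, rfl⟩ := Nat.exists_eq_add_of_lt hn'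
    have hnN := le_trans (le_max_left _ _) hn
    have h1 := EventuallyLacunary.pow_mul_le hq h hnN (M + j + 1)
    have h2 := (hN' (n + (M + j + 1)) (by have := le_max_right N N'; omega)).1
    have h3 : (d n : ℝ) ≤ s n := by
      exact_mod_cast (hN' n (le_trans (le_max_right _ _) hn)).2
    have h4 : 4 / c ≤ q ^ (M + j + 1) :=
      hM.le.trans (pow_le_pow_right₀ hq.le (by omega))
    have h5 : (4 * d n : ℝ) ≤ d (n + (M + j + 1)) := by
      calc (4 * d n : ℝ) ≤ 4 * s n := by gcongr
        _ = c * (4 / c * s n) := by field_simp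
        _ ≤ c * (q ^ (M + j + 1) * s n) := by gcongr
        _ ≤ c * s (n + (M + j + 1)) := by gcongr
        _ ≤ _ := h2
    rw [show n + M + j + 1 = n + (M + j + 1) by omega]
    exact_mod_cast h5

theorem EventuallyLacunary.tendsto_atTop {s : ℕ → ℕ} (hs : EventuallyLacunary s) :
    Tendsto s atTop atTop := by
  obtain ⟨q, hq, N, h⟩ := hs
  rw [← tendsto_add_atTop_iff_nat N, ← tendsto_natCast_atTop_iff (R := ℝ)]
  refine tendsto_atTop_mono (fun n => ?_) (tendsto_pow_atTop_atTop_of_one_lt hq)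
  have h1 := EventuallyLacunary.pow_mul_le hq h le_rfl n
  have h2 : (1 : ℝ) ≤ s N := by exact_mod_cast (h N le_rfl).1
  rw [add_comm n N]
  exact le_trans (le_mul_of_one_le_right (by positivity) h2) h1

theorem EventuallyLacunary.comp_add {s : ℕ → ℕ} (hs : EventuallyLacunary s) (j : ℕ) :
    EventuallyLacunary (fun n => s (n + j)) := by
  obtain ⟨q, hq, N, h⟩ := hs
  refine ⟨q, hq, N, fun n hn => ?_⟩
  have := h (n + j) (by omega)
  rwa [add_right_comm] at this

theorem EventuallyLacunary.not_tendsto_const {s : ℕ → ℕ} (hs : EventuallyLacunary s)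
    {U : Ultrafilter ℕ} (hU : (U : Filter ℕ) ≤ cofinite) (v : ℕ) :
    ∃ x : UnitAddCircle, ¬ Tendsto (fun n => s n • x) U (𝓝 (v • x)) := by
  have hv := hs.tendsto_atTop.eventually_ge_atTop (2 * v)
  obtain ⟨M, N, h⟩ := hs.eventuallyQuadruples (d := fun n => s n - v) (c := 1 / 2)
    (by norm_num) (by
      filter_upwards [hv] with n hn
      refine ⟨?_, Nat.sub_le _ _⟩
      have : (2 * v : ℝ) ≤ s n := by exact_mod_cast hn
      rw [Nat.cast_sub (by omega)]
      linarith)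
  obtain ⟨x, hx⟩ := exists_not_tendsto_nsmul_zero hU h
  refine ⟨x, fun ht => hx ?_⟩
  have h0 := ht.sub_const (v • x)
  rw [sub_self] at h0
  refine h0.congr' ?_
  filter_upwards [hU (Nat.cofinite_eq_atTop ▸ hv)] with n hn
  rw [sub_nsmul _ (by omega : v ≤ s n), sub_eq_add_neg]

/-- A nonprincipal ultrafilter and its shift by `j ≠ 0` have different Bohr limits along `s`: the
differences `s (n + j) - s n` are comparable to the lacunary sequence `s (n + j)`, hence do not tend
to `0`. -/
theorem EventuallyLacunary.not_tendsto_shift {s : ℕ → ℕ} (hs : EventuallyLacunary s)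
    {U : Ultrafilter ℕ} (hU : (U : Filter ℕ) ≤ cofinite) {j : ℕ} (hj : j ≠ 0) :
    ∃ x : UnitAddCircle, ∀ y, Tendsto (fun n => s n • x) U (𝓝 y) →
      ¬ Tendsto (fun n => s (n + j) • x) U (𝓝 y) := by
  obtain ⟨q, hq, N₀, hl⟩ := id hs
  have hlt : ∀ᶠ n in atTop, q * s n ≤ s (n + j) := by
    filter_upwards [eventually_ge_atTop N₀] with n hn
    refine le_trans ?_ (EventuallyLacunary.pow_mul_le hq hl hn j)
    gcongr
    exact le_self_pow₀ hq.le hj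
  have hle : ∀ᶠ n in atTop, s n ≤ s (n + j) := by
    filter_upwards [hlt] with n hn
    have : (s n : ℝ) ≤ s (n + j) := (le_mul_of_one_le_left (by positivity) hq.le).trans hn
    exact_mod_cast this
  obtain ⟨M, N, h⟩ := (hs.comp_add j).eventuallyQuadruples (d := fun n => s (n + j) - s n)
    (c := 1 - 1 / q) (by rw [sub_pos, div_lt_one (by linarith)]; exact hq) (by
      filter_upwards [hlt, hle] with n hn hn'
      refine ⟨?_, Nat.sub_le _ _⟩
      rw [Nat.cast_sub hn', sub_mul, one_mul, one_div_mul_eq_div]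
      gcongr
      rw [le_div_iff₀ (by linarith)]
      linarith)
  obtain ⟨x, hx⟩ := exists_not_tendsto_nsmul_zero hU h
  refine ⟨x, fun y hy hy' => hx ?_⟩
  have h0 := hy'.sub hy
  rw [sub_self] at h0
  refine h0.congr' ?_
  filter_upwards [hU (Nat.cofinite_eq_atTop ▸ hle)] with n hn
  rw [sub_nsmul _ hn, sub_eq_add_neg]

theorem UnitAddCircle.eq_of_forall_nsmul_eq {a b : ℕ} (h : ∀ x : UnitAddCircle, a • x = b • x) :
    a = b := by
  have hpos : (0 : ℝ) < a + b + 1 := by positivity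
  -- At `1 / (a + b + 1)` both multiples have representatives in `[0, 1)`.
  have h1 := h (((1 : ℝ) / (a + b + 1) : ℝ) : UnitAddCircle)
  rw [← AddCircle.coe_nsmul, ← AddCircle.coe_nsmul,
    AddCircle.coe_eq_coe_iff_of_mem_Ico (a := 0)] at h1
  · simp only [nsmul_eq_mul] at h1
    field_simp at h1
    exact_mod_cast h1
  all_goals
    rw [nsmul_eq_mul, mul_one_div, zero_add]
    refine ⟨by positivity, (div_lt_one hpos).2 ?_⟩
    have ha : (0 : ℝ) ≤ a := a.cast_nonneg
    have hb : (0 : ℝ) ≤ b := b.cast_nonneg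
    linarith

/-- Two nonprincipal ultrafilters that are not shifts of each other contain sets `A` and `B` that are
far apart, so that `s` quadruples along `A ∪ B`; then `s n • x` can be placed near `0` on `A` and
near `1 / 2` on `B`. -/
theorem EventuallyLacunary.exists_separation {s : ℕ → ℕ} (hs : EventuallyLacunary s)
    {U V : Ultrafilter ℕ} (hU : (U : Filter ℕ) ≤ cofinite) (hV : (V : Filter ℕ) ≤ cofinite)
    (hUV : ∀ j, V ≠ U.map (· + j)) (hVU : ∀ j, U ≠ V.map (· + j)) :
    ∃ x : UnitAddCircle, ∀ y, Tendsto (fun n => s n • x) U (𝓝 y) →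
      ¬ Tendsto (fun n => s n • x) V (𝓝 y) := by
  classical
  obtain ⟨M, N, h⟩ := hs.eventuallyQuadruples (d := s) one_pos (by simp)
  -- Sets in `U` and `V` between which no difference in `0, …, M` occurs, in one direction.
  have key : ∀ {U V : Ultrafilter ℕ}, (∀ j, V ≠ U.map (· + j)) →
      ∃ A ∈ U, ∃ B ∈ V, ∀ a ∈ A, ∀ b ∈ B, ∀ j ≤ M, a + j ≠ b := by
    intro U V hUV
    have h1 : ∀ j, ∃ B ∈ V, {n | n + j ∉ B} ∈ U := by
      intro j
      by_contra! hcon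
      exact hUV j (Ultrafilter.coe_injective (V.unique
        (g := (U.map (· + j) : Ultrafilter ℕ)) fun B hB =>
          Ultrafilter.compl_notMem_iff.1 (hcon B hB))).symm
    choose B hB hA using h1
    refine ⟨⋂ j ∈ Finset.range (M + 1), {n | n + j ∉ B j}, ?_,
      ⋂ j ∈ Finset.range (M + 1), B j, ?_, ?_⟩
    · exact (Filter.biInter_finset_mem _).2 fun j _ => hA j
    · exact (Filter.biInter_finset_mem _).2 fun j _ => hB j
    · rintro a ha b hb j hj rfl
      simp only [Finset.mem_range, mem_iInter, mem_ofPred_eq] at ha hb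
      exact ha j (by omega) (hb j (by omega))
  obtain ⟨A₁, hA₁, B₁, hB₁, h₁⟩ := key hUV
  obtain ⟨B₂, hB₂, A₂, hA₂, h₂⟩ := key hVU
  obtain ⟨i, hi⟩ := U.exists_mod_eq M
  obtain ⟨i', hi'⟩ := V.exists_mod_eq M
  have hNU : ∀ᶠ n in (U : Filter ℕ), N ≤ n :=
    hU (Nat.cofinite_eq_atTop ▸ eventually_ge_atTop N)
  have hNV : ∀ᶠ n in (V : Filter ℕ), N ≤ n :=
    hV (Nat.cofinite_eq_atTop ▸ eventually_ge_atTop N)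
  let A := {n | (n ∈ A₁ ∧ n ∈ A₂) ∧ n % (M + 1) = i ∧ N ≤ n}
  let B := {n | (n ∈ B₁ ∧ n ∈ B₂) ∧ n % (M + 1) = i' ∧ N ≤ n}
  have hA : A ∈ U := ((show ∀ᶠ n in (U : Filter ℕ), n ∈ A₁ from hA₁).and hA₂).and (hi.and hNU)
  have hB : B ∈ V := ((show ∀ᶠ n in (V : Filter ℕ), n ∈ B₁ from hB₁).and hB₂).and (hi'.and hNV)
  have hAB : ∀ n ∈ A, n ∉ B := fun n hn hn' =>
    h₁ n hn.1.1 n hn'.1.1 0 (Nat.zero_le _) rfl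
  have hN : ∀ n ∈ A ∪ B, N ≤ n := by
    rintro n (hn | hn)
    exacts [hn.2.2, hn.2.2]
  have hgap : ∀ m ∈ A ∪ B, ∀ n ∈ A ∪ B, m < n → m + M < n := by
    rintro m (hm | hm) n (hn | hn) hmn
    · exact add_lt_of_mod_eq (hm.2.1.trans hn.2.1.symm) hmn
    · by_contra hcon
      exact h₁ m hm.1.1 n hn.1.1 (n - m) (by omega) (by omega)
    · by_contra hcon
      exact h₂ m hm.1.2 n hn.1.2 (n - m) (by omega) (by omega)
    · exact add_lt_of_mod_eq (hm.2.1.trans hn.2.1.symm) hmn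
  obtain ⟨x, hx⟩ := exists_forall_norm_nsmul_sub_le (S := A ∪ B)
    ((Ultrafilter.infinite_of_mem hU hA).mono subset_union_left)
    (fun n hn => (h n (hN n hn)).1)
    (fun m hm n hn hmn => (h m (hN m hm)).2 n (hgap m hm n hn hmn))
    (fun n => if n ∈ A then 0 else 1 / 2)
  refine ⟨x, fun y hy hy' => ?_⟩
  have e1 : ‖y‖ ≤ 1 / 6 := by
    refine le_of_tendsto hy.norm ?_
    filter_upwards [hA] with n hn
    simpa [hn] using hx n (Or.inl hn)
  have e2 : ‖y - ((1 / 2 : ℝ) : UnitAddCircle)‖ ≤ 1 / 6 := by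
    refine le_of_tendsto (hy'.sub_const _).norm ?_
    filter_upwards [hB] with n hn
    have hnA : n ∉ A := fun hn' => hAB n hn' hn
    simpa only [hnA, if_false] using hx n (Or.inr hn)
  have e3 := norm_sub_norm_le ((1 / 2 : ℝ) : UnitAddCircle) y
  rw [norm_sub_rev] at e3
  rw [UnitAddCircle.norm_half] at e3
  linarith

/-- Along an eventually lacunary sequence, ultrafilters with the same Bohr limit have the same image.
The images are compared, not the ultrafilters, since the first terms may repeat. -/
theorem EventuallyLacunary.map_eq_map {s : ℕ → ℕ} (hs : EventuallyLacunary s)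
    {U V : Ultrafilter ℕ} {k : UnitAddCircle → UnitAddCircle}
    (hU : ∀ x, Tendsto (fun n => s n • x) U (𝓝 (k x)))
    (hV : ∀ x, Tendsto (fun n => s n • x) V (𝓝 (k x))) : U.map s = V.map s := by
  have hpure : ∀ {U : Ultrafilter ℕ} {a : ℕ}, U = pure a →
      (∀ x, Tendsto (fun n => s n • x) U (𝓝 (k x))) → ∀ x, k x = s a • x := by
    rintro _ a rfl h x
    exact tendsto_nhds_unique (h x) (by simpa using tendsto_pure_nhds _ _)
  rcases U.le_cofinite_or_eq_pure with hUc | ⟨a, ha⟩ <;>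
    rcases V.le_cofinite_or_eq_pure with hVc | ⟨b, hb⟩
  · by_cases h1 : ∃ j, V = U.map (· + j)
    · obtain ⟨j, rfl⟩ := h1
      rcases eq_or_ne j 0 with rfl | hj
      · rfl
      · obtain ⟨x, hx⟩ := hs.not_tendsto_shift hUc hj
        exact (hx _ (hU x) (hV x)).elim
    by_cases h2 : ∃ j, U = V.map (· + j)
    · obtain ⟨j, rfl⟩ := h2
      rcases eq_or_ne j 0 with rfl | hj
      · rfl
      · obtain ⟨x, hx⟩ := hs.not_tendsto_shift hVc hj
        exact (hx _ (hV x) (hU x)).elim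
    push Not at h1 h2
    obtain ⟨x, hx⟩ := hs.exists_separation hUc hVc h1 h2
    exact (hx _ (hU x) (hV x)).elim
  · obtain ⟨x, hx⟩ := hs.not_tendsto_const hUc (s b)
    exact (hx (hpure hb hV x ▸ hU x)).elim
  · obtain ⟨x, hx⟩ := hs.not_tendsto_const hVc (s a)
    exact (hx (hpure ha hU x ▸ hV x)).elim
  · have hab : s a = s b := UnitAddCircle.eq_of_forall_nsmul_eq fun x =>
      (hpure ha hU x).symm.trans (hpure hb hV x)
    rw [ha, hb, Ultrafilter.map_pure, Ultrafilter.map_pure, hab]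

/-! ### Continuous functions on the Bohr compactification -/

theorem isTrigPolynomial_of_fintype {ι : Type*} [Fintype ι] {P : ℕ+ → ℂ} (c : ι → ℂ)
    (α : ι → ℝ) (h : ∀ n : ℕ+, P n = ∑ j, c j *
      Complex.exp (2 * (Real.pi : ℂ) * Complex.I * ((n : ℕ) : ℂ) * (α j : ℂ))) :
    IsTrigPolynomial P :=
  let e := (Fintype.equivFin ι).symm
  ⟨_, c ∘ e, α ∘ e, fun n => (h n).trans (Equiv.sum_comp e _).symm⟩

theorem IsTrigPolynomial.add {P Q : ℕ+ → ℂ} (hP : IsTrigPolynomial P) (hQ : IsTrigPolynomial Q) :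
    IsTrigPolynomial (fun n => P n + Q n) := by
  obtain ⟨k, c, α, h⟩ := hP
  obtain ⟨l, d, β, h'⟩ := hQ
  exact isTrigPolynomial_of_fintype (Sum.elim c d) (Sum.elim α β) fun n => by
    simp [h, h']

theorem IsTrigPolynomial.mul {P Q : ℕ+ → ℂ} (hP : IsTrigPolynomial P) (hQ : IsTrigPolynomial Q) :
    IsTrigPolynomial (fun n => P n * Q n) := by
  obtain ⟨k, c, α, h⟩ := hP
  obtain ⟨l, d, β, h'⟩ := hQ
  refine isTrigPolynomial_of_fintype (fun p : Fin k × Fin l => c p.1 * d p.2)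
    (fun p => α p.1 + β p.2) fun n => ?_
  rw [h, h', Finset.sum_mul_sum, Fintype.sum_prod_type]
  refine Finset.sum_congr rfl fun i _ => Finset.sum_congr rfl fun j _ => ?_
  rw [Complex.ofReal_add, mul_add, Complex.exp_add]
  ring

theorem isTrigPolynomial_const (z : ℂ) : IsTrigPolynomial (fun _ => z) :=
  ⟨1, fun _ => z, fun _ => 0, fun n => by simp⟩

theorem IsTrigPolynomial.star {P : ℕ+ → ℂ} (hP : IsTrigPolynomial P) :
    IsTrigPolynomial (fun n => star (P n)) := by
  obtain ⟨k, c, α, h⟩ := hP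
  refine ⟨k, fun j => Star.star (c j), fun j => -α j, fun n => ?_⟩
  dsimp only
  rw [h, star_sum]
  refine Finset.sum_congr rfl fun j _ => ?_
  rw [star_mul', Complex.star_def, ← Complex.exp_conj]
  simp [map_ofNat (starRingEnd ℂ) 2]

theorem toCircle_nsmul_coe (n : ℕ) (a : ℝ) :
    (AddCircle.toCircle (n • (a : UnitAddCircle)) : ℂ)
      = Complex.exp (2 * (Real.pi : ℂ) * Complex.I * (n : ℂ) * (a : ℂ)) := by
  rw [← AddCircle.coe_nsmul, AddCircle.toCircle_apply_mk, Circle.coe_exp]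
  congr 1
  push_cast
  simp
  ring

/-- The image of `n` in the compact group of all functions from the circle to itself, with
`x ↦ n • x`. The closure of the range of this map is the Bohr compactification of the integers; the
ambient product is as good for the purpose of restricting continuous functions. -/
def bohrPoint (n : ℕ+) (x : UnitAddCircle) : UnitAddCircle := (n : ℕ) • x

/-- The continuous functions on the product of circles that restrict to trigonometric polynomials. -/
noncomputable def bohrTrigSubalgebra :
    StarSubalgebra ℂ C(UnitAddCircle → UnitAddCircle, ℂ) where
  carrier := {g | IsTrigPolynomial fun n => g (bohrPoint n)}
  mul_mem' hf hg := hf.mul hg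
  add_mem' hf hg := hf.add hg
  algebraMap_mem' z := isTrigPolynomial_const z
  star_mem' hf := hf.star

theorem bohrTrigSubalgebra_separatesPoints :
    bohrTrigSubalgebra.toSubalgebra.SeparatesPoints := by
  intro y z hyz
  obtain ⟨x, hx⟩ := Function.ne_iff.1 hyz
  refine ⟨_, ⟨(⟨fun w => (AddCircle.toCircle (w x) : ℂ), by
    have := AddCircle.continuous_toCircle (T := 1)
    fun_prop⟩ : C(UnitAddCircle → UnitAddCircle, ℂ)), ?_, rfl⟩, fun h => hx ?_⟩
  · obtain ⟨a, rfl⟩ := QuotientAddGroup.mk_surjective x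
    exact ⟨1, fun _ => 1, fun _ => a, fun n => by
      simpa using! toCircle_nsmul_coe n a⟩
  · exact AddCircle.injective_toCircle one_ne_zero (Circle.coe_injective h)

theorem isBohrAlmostPeriodic_comp_bohrPoint (g : C(UnitAddCircle → UnitAddCircle, ℂ)) :
    IsBohrAlmostPeriodic fun n => g (bohrPoint n) := by
  intro ε hε
  have hg : g ∈ closure (bohrTrigSubalgebra : Set C(UnitAddCircle → UnitAddCircle, ℂ)) := by
    rw [← StarSubalgebra.topologicalClosure_coe,
      ContinuousMap.starSubalgebra_topologicalClosure_eq_top_of_separatesPoints _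
        bohrTrigSubalgebra_separatesPoints]
    trivial
  obtain ⟨h, hh, hgh⟩ := Metric.mem_closure_iff.1 hg ε hε
  refine ⟨_, hh, fun n => ?_⟩
  rw [← dist_eq_norm]
  exact (ContinuousMap.dist_apply_le_dist _).trans_lt hgh

/-- If an ultrafilter on `E` is determined by its limit in the Bohr compactification, then `E` is an
`I₀`-set: the Stone–Čech compactification of the discrete space `E`, realised as `Ultrafilter E`,
embeds in the product of circles, so a bounded function extends by Tietze's theorem. -/
theorem isI0Set_of_injective_limits {E : Set ℕ+}
    (hE : ∀ (U V : Ultrafilter E) (k : UnitAddCircle → UnitAddCircle),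
      (∀ x, Tendsto (fun e : E => ((e : ℕ+) : ℕ) • x) U (𝓝 (k x))) →
      (∀ x, Tendsto (fun e : E => ((e : ℕ+) : ℕ) • x) V (𝓝 (k x))) → U = V) :
    IsI0Set E := by
  rintro f ⟨C, hC⟩
  let ι : E → UnitAddCircle → UnitAddCircle := fun e => bohrPoint e
  have hι : ∀ U : Ultrafilter E, Tendsto ι U (𝓝 (Ultrafilter.extend ι U)) := fun U =>
    ultrafilter_extend_eq_iff.1 rfl
  have hinj : Function.Injective (Ultrafilter.extend ι) := fun U V hUV =>
    hE U V _ (tendsto_pi_nhds.1 (hι U)) (tendsto_pi_nhds.1 (hUV ▸ hι V))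
  have hemb : IsClosedEmbedding (Ultrafilter.extend ι) :=
    (continuous_ultrafilter_extend ι).isClosedEmbedding hinj
  let f' : E → Metric.closedBall (0 : ℂ) C := fun e => ⟨f e, by simpa using hC e⟩
  obtain ⟨g, hg⟩ := ContinuousMap.exists_extension' hemb
    (⟨fun U => ((Ultrafilter.extend f' U : Metric.closedBall (0 : ℂ) C) : ℂ),
      continuous_subtype_val.comp (continuous_ultrafilter_extend f')⟩ : C(Ultrafilter E, ℂ))
  refine ⟨_, isBohrAlmostPeriodic_comp_bohrPoint g, fun e => ?_⟩
  have h := congrFun hg (pure e)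
  simpa [ultrafilter_extend_pure] using h

/-! ### Non-recurrence gives an `I₀`-set -/

theorem IsLacunarySeq.exists_ratio {r : ℕ → ℕ+} (hr : IsLacunarySeq r) :
    ∃ q : ℝ, 1 < q ∧ ∀ n, q * (r n : ℕ) ≤ (r (n + 1) : ℕ) := by
  refine ⟨_, hr.2, fun n => ?_⟩
  rw [← le_div_iff₀ (by exact_mod_cast (r n).pos)]
  exact ciInf_le ⟨0, by rintro _ ⟨n, rfl⟩; positivity⟩ n

/-- Any mixture of `r n` and `r n + t n`, one choice for each `n`, is eventually lacunary. -/
theorem eventuallyLacunary_add_selection {r t : ℕ → ℕ+} (hr : IsLacunarySeq r)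
    (ht : Tendsto (fun n : ℕ => ((t n : ℕ) : ℝ) / ((r n : ℕ) : ℝ)) atTop (𝓝 0))
    (b : ℕ → Bool) :
    EventuallyLacunary fun n => (r n : ℕ) + (b n).toNat * (t n : ℕ) := by
  obtain ⟨q, hq, h⟩ := hr.exists_ratio
  have hq' : (1 : ℝ) < (1 + q) / 2 := by linarith
  obtain ⟨N, hN⟩ := eventually_atTop.1
    (ht.eventually_le_const (show (0 : ℝ) < q / ((1 + q) / 2) - 1 by
      rw [sub_pos, lt_div_iff₀ (by linarith)]; linarith))
  refine ⟨(1 + q) / 2, hq', N, fun n hn => ⟨Nat.add_pos_left (r n).pos _, ?_⟩⟩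
  have h1 := hN n hn
  have hrn : (0 : ℝ) < (r n : ℕ) := by exact_mod_cast (r n).pos
  rw [div_le_iff₀ hrn, sub_mul, one_mul, le_sub_iff_add_le'] at h1
  have h2 : ((b n).toNat * (t n : ℕ) : ℝ) ≤ (t n : ℕ) :=
    mul_le_of_le_one_left (Nat.cast_nonneg _) (by exact_mod_cast Bool.toNat_le (b n))
  push_cast
  calc (1 + q) / 2 * ((r n : ℕ) + (b n).toNat * (t n : ℕ) : ℝ)
      ≤ (1 + q) / 2 * (q / ((1 + q) / 2) * (r n : ℕ)) := by
        gcongr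
        linarith
    _ = q * (r n : ℕ) := by field_simp
    _ ≤ (r (n + 1) : ℕ) := h n
    _ ≤ _ := le_add_of_nonneg_right (by positivity)

theorem isBohrRecurrent_range_of_tendsto {t : ℕ → ℕ+} {U : Ultrafilter ℕ}
    (h : ∀ x : UnitAddCircle, Tendsto (fun n => (t n : ℕ) • x) U (𝓝 0)) :
    IsBohrRecurrent (range t) := fun _ α =>
  mem_closure_of_tendsto (f := fun n => (t n : ℕ) • α) (b := (U : Filter ℕ))
    (tendsto_pi_nhds.2 fun j => h (α j))
    (Eventually.of_forall fun n => mem_image_of_mem _ (mem_range_self n))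

theorem isI0Set_of_not_isBohrRecurrent {r t : ℕ → ℕ+} (hr : IsLacunarySeq r)
    (ht : Tendsto (fun n : ℕ => ((t n : ℕ) : ℝ) / ((r n : ℕ) : ℝ)) atTop (𝓝 0))
    (hrec : ¬ IsBohrRecurrent (range t)) :
    IsI0Set (range r ∪ range fun n => r n + t n) := by
  classical
  refine isI0Set_of_injective_limits fun U V k hU hV => ?_
  have hindex : ∀ e : ↥(range r ∪ range fun n => r n + t n), ∃ (n : ℕ) (b : Bool),
      ((e : ℕ+) : ℕ) = (r n : ℕ) + b.toNat * (t n : ℕ) := by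
    rintro ⟨_, ⟨n, rfl⟩ | ⟨n, rfl⟩⟩
    · exact ⟨n, false, by simp⟩
    · exact ⟨n, true, by simp⟩
  choose i b hib using hindex
  -- An ultrafilter on `E` lives on one of the two sequences `r` and `r + t`.
  have hconst : ∀ U : Ultrafilter ↥(range r ∪ range fun n => r n + t n),
      ∃ β : Bool, ∀ᶠ e in (U : Filter _), b e = β := by
    intro U
    rcases U.mem_or_compl_mem {e | b e = true} with h | h
    · exact ⟨true, h⟩
    · refine ⟨false, ?_⟩
      filter_upwards [h] with e he
      simpa using he
  obtain ⟨β, hβ⟩ := hconst U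
  obtain ⟨β', hβ'⟩ := hconst V
  have hlim : ∀ {W : Ultrafilter ↥(range r ∪ range fun n => r n + t n)} {γ : Bool},
      (∀ᶠ e in (W : Filter _), b e = γ) →
      (∀ x, Tendsto (fun e : ↥(range r ∪ range fun n => r n + t n) =>
        ((e : ℕ+) : ℕ) • x) W (𝓝 (k x))) →
      ∀ x, Tendsto (fun n => ((r n : ℕ) + γ.toNat * (t n : ℕ)) • x) (W.map i) (𝓝 (k x)) := by
    intro W γ hγ hW x
    refine tendsto_map'_iff.2 ((hW x).congr' ?_)
    filter_upwards [hγ] with e he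
    rw [hib, he, Function.comp_apply]
  have hval : ∀ {W : Ultrafilter ↥(range r ∪ range fun n => r n + t n)} {γ : Bool},
      (∀ᶠ e in (W : Filter _), b e = γ) →
      (W.map i).map (fun n => (r n : ℕ) + γ.toNat * (t n : ℕ))
        = W.map (fun e => ((e : ℕ+) : ℕ)) := by
    intro W γ hγ
    refine Ultrafilter.coe_injective ?_
    rw [Ultrafilter.coe_map, Ultrafilter.coe_map, Ultrafilter.coe_map, Filter.map_map]
    refine Filter.map_congr ?_
    filter_upwards [hγ] with e he
    rw [hib e, he, Function.comp_apply]
  have hlimU := hlim hβ hU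
  have hlimV := hlim hβ' hV
  suffices h : U.map (fun e => ((e : ℕ+) : ℕ)) = V.map (fun e => ((e : ℕ+) : ℕ)) from
    Ultrafilter.coe_injective (Filter.map_injective
      (PNat.coe_injective.comp Subtype.val_injective)
      (congrArg (fun W : Ultrafilter ℕ => (W : Filter ℕ)) h))
  refine (hval hβ).symm.trans (Eq.trans ?_ (hval hβ'))
  by_cases hUV : U.map i = V.map i
  · rw [← hUV] at hlimV ⊢
    by_cases hββ : β = β'
    · rw [hββ]
    · -- The difference of the two sequences is `t`, which would tend to `0`.
      refine (hrec (isBohrRecurrent_range_of_tendsto (U := U.map i) fun x => ?_)).elim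
      cases β <;> cases β'
      · exact (hββ rfl).elim
      · simpa [add_nsmul] using (hlimV x).sub (hlimU x)
      · simpa [add_nsmul] using (hlimU x).sub (hlimV x)
      · exact (hββ rfl).elim
  · obtain ⟨A, hAU, hAV⟩ : ∃ A, A ∈ U.map i ∧ A ∉ V.map i := by
      by_contra! hcon
      exact hUV (Ultrafilter.coe_injective ((U.map i).unique (g := (V.map i : Ultrafilter ℕ))
        hcon)).symm
    have hAV' : Aᶜ ∈ V.map i := Ultrafilter.compl_mem_iff_notMem.2 hAV
    let s : ℕ → ℕ := fun n => (r n : ℕ) + (if n ∈ A then β else β').toNat * (t n : ℕ)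
    have hs : EventuallyLacunary s := eventuallyLacunary_add_selection hr ht _
    have hsU : (fun n => (r n : ℕ) + β.toNat * (t n : ℕ)) =ᶠ[(U.map i : Filter ℕ)] s := by
      filter_upwards [hAU] with n hn
      simp [s, hn]
    have hsV : (fun n => (r n : ℕ) + β'.toNat * (t n : ℕ)) =ᶠ[(V.map i : Filter ℕ)] s := by
      filter_upwards [hAV'] with n hn
      rw [mem_compl_iff] at hn
      simp [s, hn]
    have hmap := hs.map_eq_map
      (fun x => (hlimU x).congr' (hsU.mono fun n hn => congrArg (· • x) hn))
      (fun x => (hlimV x).congr' (hsV.mono fun n hn => congrArg (· • x) hn))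
    refine Ultrafilter.coe_injective ?_
    have hmap' := congrArg (fun W : Ultrafilter ℕ => (W : Filter ℕ)) hmap
    simp only [Ultrafilter.coe_map] at hmap' ⊢
    exact (Filter.map_congr hsU).trans (hmap'.trans (Filter.map_congr hsV).symm)

/-! ### Recurrence prevents an `I₀`-set -/

/-- Recurrence of `t` yields good return times `t n` with `n` arbitrarily large: adding the
coordinate `1 / (M + 1)` to `α` forces `t n > M`, where `M` bounds the first `N` terms. -/
theorem IsBohrRecurrent.exists_ge_comp_lt {t : ℕ → ℕ+} (h : IsBohrRecurrent (range t))
    (N : ℕ) {k : ℕ} (α : Fin k → UnitAddCircle) {G : (Fin k → UnitAddCircle) → ℝ}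
    (hG : Continuous G) {ε : ℝ} (hG0 : G 0 < ε) :
    ∃ n, N ≤ n ∧ G (fun j => (t n : ℕ) • α j) < ε := by
  let M : ℕ := ∑ m ∈ Finset.range N, (t m : ℕ)
  have hMpos : (0 : ℝ) < M + 1 := by positivity
  let O : Set (Fin (k + 1) → UnitAddCircle) :=
    {y | ‖y 0‖ < 1 / (M + 1)} ∩ {y | G (fun j => y j.succ) < ε}
  have hO : IsOpen O :=
    (isOpen_lt (by fun_prop) continuous_const).inter (isOpen_lt (by fun_prop) continuous_const)
  have h0 : (0 : Fin (k + 1) → UnitAddCircle) ∈ O :=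
    ⟨by simpa using hMpos, hG0⟩
  obtain ⟨_, ⟨hn1, hn2⟩, _, ⟨n, rfl⟩, rfl⟩ := mem_closure_iff.1
    (h (k + 1) (Fin.cons ((1 / (M + 1) : ℝ) : UnitAddCircle) α)) O hO h0
  refine ⟨n, ?_, by simpa using hn2⟩
  by_contra! hlt
  have hle : (t n : ℕ) ≤ M := Finset.single_le_sum (f := fun m => (t m : ℕ))
    (fun _ _ => Nat.zero_le _) (Finset.mem_range.2 hlt)
  have hpos := (t n).pos
  have hnorm := AddCircle.norm_div_natCast (p := 1) (m := (t n : ℕ)) (n := M + 1)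
  rw [Nat.mod_eq_of_lt (by omega), mul_one, one_mul] at hnorm
  have hn1' : ‖(((t n : ℕ) / (M + 1 : ℕ) : ℝ) : UnitAddCircle)‖ < 1 / (M + 1) := by
    have hn1 : ‖(t n : ℕ) • ((1 / (M + 1) : ℝ) : UnitAddCircle)‖ < 1 / (M + 1) := hn1
    rw [← AddCircle.coe_nsmul, nsmul_eq_mul, mul_one_div] at hn1
    exact_mod_cast hn1
  rw [hnorm] at hn1'
  push_cast at hn1'
  rw [div_lt_div_iff_of_pos_right hMpos] at hn1'
  have hmin : 1 ≤ min (t n : ℕ) (M + 1 - t n) := le_min hpos (by omega)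
  exact absurd hn1' (not_lt.2 (by exact_mod_cast hmin))

/-- If `E` is an `I₀`-set, the indicator function of a tail of `r n + t n` extends to an almost
periodic `ψ`. Recurrence would give an `n` with `ψ (r n + t n)` near `ψ (r n)`, while these values
are `1` and `0`. -/
theorem not_isBohrRecurrent_of_isI0Set {r t : ℕ → ℕ+} (hr : IsLacunarySeq r)
    (ht : Tendsto (fun n : ℕ => ((t n : ℕ) : ℝ) / ((r n : ℕ) : ℝ)) atTop (𝓝 0))
    (hE : IsI0Set (range r ∪ range fun n => r n + t n)) : ¬ IsBohrRecurrent (range t) := by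
  classical
  intro hrec
  obtain ⟨q, hq, hqr⟩ := hr.exists_ratio
  obtain ⟨N, hN⟩ := eventually_atTop.1 (ht.eventually_lt_const (sub_pos.2 hq))
  -- In the tail, `r m + t m` lies strictly between consecutive terms of `r`.
  have hlt : ∀ m, N ≤ m → r m + t m < r (m + 1) := by
    intro m hm
    have h1 := hN m hm
    rw [div_lt_iff₀ (by exact_mod_cast (r m).pos)] at h1
    have h2 : ((r m : ℕ) + (t m : ℕ) : ℝ) < (r (m + 1) : ℕ) := by linarith [hqr m]
    rw [← PNat.coe_lt_coe]
    exact_mod_cast h2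
  have hne : ∀ m n, N ≤ m → r m + t m ≠ r n := by
    intro m n hm hmn
    have h1 : r m < r n := hmn ▸ PNat.lt_add_right _ _
    have h2 : r n < r (m + 1) := hmn ▸ hlt m hm
    have := hr.1.lt_iff_lt.1 h1
    have := hr.1.lt_iff_lt.1 h2
    omega
  obtain ⟨ψ, hψ, hψE⟩ := hE
    (fun e => if ∃ m, N ≤ m ∧ (e : ℕ+) = r m + t m then 1 else 0)
    ⟨1, fun e => by split_ifs <;> simp⟩
  obtain ⟨P, ⟨k, c, α, hP⟩, hψP⟩ := hψ (1 / 4) (by norm_num)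
  obtain ⟨n, hNn, hn⟩ := hrec.exists_ge_comp_lt N (fun j => (α j : UnitAddCircle))
    (G := fun y => ∑ j, ‖c j‖ * ‖(AddCircle.toCircle (y j) : ℂ) - 1‖)
    (by
      have := AddCircle.continuous_toCircle (T := 1)
      fun_prop)
    (ε := 1 / 2) (by simp)
  have hψ0 : ψ (r n) = 0 := by
    rw [hψE ⟨r n, Or.inl ⟨n, rfl⟩⟩]
    exact if_neg fun ⟨m, hm, he⟩ => hne m n hm he.symm
  have hψ1 : ψ (r n + t n) = 1 := by
    rw [hψE ⟨r n + t n, Or.inr ⟨n, rfl⟩⟩]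
    exact if_pos ⟨n, hNn, rfl⟩
  have hdiff : ‖P (r n + t n) - P (r n)‖
      ≤ ∑ j, ‖c j‖ * ‖(AddCircle.toCircle ((t n : ℕ) • (α j : UnitAddCircle)) : ℂ) - 1‖ := by
    rw [hP, hP, ← Finset.sum_sub_distrib]
    refine (norm_sum_le _ _).trans (Finset.sum_le_sum fun j _ => le_of_eq ?_)
    rw [← toCircle_nsmul_coe, ← toCircle_nsmul_coe, PNat.add_coe, add_nsmul,
      AddCircle.toCircle_add, Circle.coe_mul, ← mul_sub, norm_mul, ← mul_sub_one, norm_mul,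
      Circle.norm_coe, one_mul]
  have h0 := hψP (r n)
  have h1 := hψP (r n + t n)
  rw [hψ0, zero_sub, norm_neg] at h0
  rw [hψ1] at h1
  have h2 : ‖(1 : ℂ)‖ ≤ ‖1 - P (r n + t n)‖ + ‖P (r n + t n) - P (r n)‖ + ‖P (r n)‖ := by
    refine le_trans (le_of_eq ?_) (norm_add₃_le (a := 1 - P (r n + t n))
      (b := P (r n + t n) - P (r n)) (c := P (r n)))
    congr 1
    ring
  rw [norm_one] at h2
  linarith

theorem proposition1p4 (r t : ℕ → ℕ+) (hr : IsLacunarySeq r)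
    (ht : Filter.Tendsto (fun n : ℕ => ((t n : ℕ) : ℝ) / ((r n : ℕ) : ℝ))
      Filter.atTop (nhds 0)) :
    IsI0Set (Set.range r ∪ Set.range (fun n : ℕ => r n + t n)) ↔
      ¬ IsBohrRecurrent (Set.range t) :=
  ⟨not_isBohrRecurrent_of_isI0Set hr ht, isI0Set_of_not_isBohrRecurrent hr ht⟩
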